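/- Let $X$ be a separable Banach space over $\mathbb{R}$ or $\mathbb{C}$ whose dual space $X^*$ is non-separable in its norm topology. Then for every $\delta > 0$ there exists a norm-closed linear subspace $Y \subseteq X$ such that $Y^*$ is non-separable and $Y$ has a (Schauder) basis $(e_n)_{n=0}^{\infty}$ with basis constant not exceeding $1+\delta$. Here the basis constant is $\sup_n \|P_n\|$, where $P_n : Y \to Y$ is the projection $\sum_{i=0}^\infty a_i e_i \mapsto \sum_{i<n} a_i e_i$. -/

import Mathlib

open Set Filter Topology

/-! Take an uncountable `ε`-separated set in a ball of the dual, which is weak-star compact and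
metrizable as `X` is separable. Deleting its non-condensation points and cutting with a countable
base gives uncountable sets `W n`; by Baire, any countable weak-star closed cover has a member
containing some `W n`. A vector `x n` of norm at most 1 on which two members of `W n` differ by more
than `ε / 4` exists in every finite-codimensional kernel, so Mazur's method makes `x` basic. If `Y`
is its closed span and `Y*` were separable, the functionals whose restrictions to `Y` lie `ε /
8`-close to a dense sequence would give such a cover, contradicting the choice of some `x n`. -/

/-- A non-separable metric space contains an uncountable uniformly separated set. -/
theorem exists_uncountable_separated {α : Type*} [MetricSpace α]
    (h : ¬ TopologicalSpace.SeparableSpace α) :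
    ∃ ε > 0, ∃ A : Set α, ¬ A.Countable ∧ A.Pairwise fun a b => ε < dist a b := by
  by_contra! hc
  refine h ?_
  suffices SecondCountableTopology α from inferInstance
  refine Metric.secondCountable_of_almost_dense_set fun ε hε => ?_
  obtain ⟨m, hm⟩ := zorn_subset {A : Set α | A.Pairwise fun a b => ε < dist a b}
    (fun c hcS hch => ⟨⋃₀ c, (pairwise_sUnion hch.directedOn).2 hcS,
      fun s hs => subset_sUnion_of_mem hs⟩)
  refine ⟨m, by_contra fun hmc => hc ε hε m hmc hm.prop, fun x => ?_⟩
  by_contra! hx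
  have hins : insert x m ∈ {A : Set α | A.Pairwise fun a b => ε < dist a b} :=
    hm.prop.insert fun y hy _ => ⟨hx y hy, by rw [dist_comm]; exact hx y hy⟩
  have hxm : x ∈ m := hm.le_of_ge hins (subset_insert x m) (mem_insert x m)
  simpa using (hε.trans (hx x hxm)).ne'

/-- A map from an uncountable set to a separable metric space brings two points close together. -/
theorem exists_ne_dist_lt_of_not_countable {α E : Type*} [MetricSpace E]
    [TopologicalSpace.SeparableSpace E] [Nonempty E] {W : Set α} (hW : ¬ W.Countable)
    (k : α → E) {c : ℝ} (hc : 0 < c) : ∃ a ∈ W, ∃ b ∈ W, a ≠ b ∧ dist (k a) (k b) < c := by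
  by_contra! h
  have hd : ∀ a, ∃ n, dist (k a) (TopologicalSpace.denseSeq E n) < c / 2 := fun a =>
    (TopologicalSpace.denseRange_denseSeq E).exists_dist_lt (k a) (half_pos hc)
  choose g hg using hd
  refine hW ((mapsTo_univ g W).countable_of_injOn (fun a ha b hb hab => ?_) countable_univ)
  by_contra hne
  have h1 := h a ha b hb hne
  have h2 := hg a
  have h3 := hg b
  rw [← hab, dist_comm] at h3
  linarith [dist_triangle (k a) (TopologicalSpace.denseSeq E (g a)) (k b)]

/-- An uncountable subset of a second countable compact space has a sequence of uncountable
subsets that every countable closed cover of the space must detect. -/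
theorem exists_seq_uncountable_subset_of_closed_cover {T : Type*} [TopologicalSpace T]
    [CompactSpace T] [T2Space T] [SecondCountableTopology T] {A : Set T} (hA : ¬ A.Countable) :
    ∃ W : ℕ → Set T, (∀ n, W n ⊆ A ∧ ¬ (W n).Countable) ∧
      ∀ C : ℕ → Set T, (∀ j, IsClosed (C j)) → ⋃ j, C j = univ → ∃ n j, W n ⊆ C j := by
  obtain ⟨B, hBc, -, hB⟩ := TopologicalSpace.exists_countable_basis T
  set bad : Set (Set T) := {V ∈ B | (A ∩ V).Countable}
  have hbad : (A ∩ ⋃₀ bad).Countable := by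
    rw [sUnion_eq_biUnion, inter_iUnion₂]
    exact (hBc.mono (sep_subset _ _)).biUnion fun V hV => hV.2
  -- Only condensation points of `A` remain, so a basic set meeting `A'` meets it uncountably.
  set A' : Set T := A \ ⋃₀ bad
  have hA' : ¬ A'.Countable := fun h =>
    hA ((h.union hbad).mono (by rw [sdiff_union_inter]))
  have hne : A'.Nonempty := nonempty_iff_ne_empty.2 fun h => hA' (h ▸ countable_empty)
  set good : Set (Set T) := {V ∈ B | (A' ∩ V).Nonempty}
  have hgood : good.Nonempty := by
    obtain ⟨p, hp⟩ := hne
    obtain ⟨V, hV, hpV, -⟩ := hB.exists_subset_of_mem_open (mem_univ p) isOpen_univ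
    exact ⟨V, hV, p, hp, hpV⟩
  obtain ⟨V, hV⟩ := (hBc.mono (sep_subset _ _) : good.Countable).exists_eq_range hgood
  have hVg : ∀ n, V n ∈ good := fun n => hV ▸ mem_range_self n
  refine ⟨fun n => A' ∩ V n, fun n => ⟨inter_subset_left.trans sdiff_subset, fun h => ?_⟩,
    fun C hC hU => ?_⟩
  · obtain ⟨p, hp, hpV⟩ := (hVg n).2
    refine hp.2 ⟨V n, ⟨(hVg n).1, (h.union hbad).mono ?_⟩, hpV⟩
    rintro q ⟨hqA, hqV⟩
    by_cases hq : q ∈ ⋃₀ bad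
    · exact Or.inr ⟨hqA, hq⟩
    · exact Or.inl ⟨⟨hqA, hq⟩, hqV⟩
  -- Baire category in the compact space `closure A'`: some `C j` has interior there.
  · have : Nonempty (closure A') := hne.closure.to_subtype
    have : CompactSpace (closure A') := isCompact_iff_compactSpace.1 isClosed_closure.isCompact
    obtain ⟨j, p, hp⟩ := nonempty_interior_of_iUnion_of_closed
      (f := fun j => ((↑) : closure A' → T) ⁻¹' C j)
      (fun j => (hC j).preimage continuous_subtype_val) (by rw [← preimage_iUnion, hU, preimage_univ])
    obtain ⟨U', hU's, hU'o, hpU'⟩ := mem_interior.1 hp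
    obtain ⟨U, hUo, rfl⟩ := isOpen_induced_iff.1 hU'o
    obtain ⟨V₀, hV₀, hpV₀, hVU⟩ := hB.exists_subset_of_mem_open hpU' hUo
    obtain ⟨q, hqV, hqA⟩ := mem_closure_iff.1 p.2 V₀ (hB.isOpen hV₀) hpV₀
    have : V₀ ∈ good := ⟨hV₀, q, hqA, hqV⟩
    rw [hV] at this
    obtain ⟨n, rfl⟩ := this
    exact ⟨n, j, fun r hr => hU's (a := ⟨r, subset_closure hr.1⟩) (hVU hr.2)⟩

section Banach

variable {𝕜 : Type*} [RCLike 𝕜] {X : Type*} [NormedAddCommGroup X] [NormedSpace 𝕜 X]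

/-! ### Separating vectors and basic sequences -/

/-- Two members of an uncountable separated family of functionals can be distinguished by a unit
vector annihilated by prescribed finitely many functionals. -/
theorem exists_separating_vector (S : Finset (StrongDual 𝕜 X)) {ε : ℝ} (hε : 0 < ε)
    {W : Set (StrongDual 𝕜 X)} (hW : ¬ W.Countable) (hsep : W.Pairwise fun f g => ε < dist f g) :
    ∃ x : X, ‖x‖ ≤ 1 ∧ (∀ g ∈ S, g x = 0) ∧
      ∃ f ∈ W, ∃ f' ∈ W, ε / 4 < ‖f x - f' x‖ := by
  by_contra! h
  set G : Submodule 𝕜 X := ⨅ g : S, LinearMap.ker (g.1 : X →ₗ[𝕜] 𝕜)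
  set E : Submodule 𝕜 (StrongDual 𝕜 X) := Submodule.span 𝕜 (S : Set (StrongDual 𝕜 X))
  have hGS : ∀ x ∈ G, ∀ g ∈ S, g x = 0 := fun x hx g hg => by
    simpa using (Submodule.mem_iInf _).1 hx ⟨g, hg⟩
  obtain ⟨f₀, hf₀⟩ : W.Nonempty := nonempty_iff_ne_empty.2 fun h => hW (h ▸ countable_empty)
  have key : ∀ f : W, ∃ k : E, ‖f.1 - f₀ - k‖ ≤ ε / 4 := by
    rintro ⟨f, hf⟩
    have hle : ‖(f - f₀).comp G.subtypeL‖ ≤ ε / 4 := by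
      refine ContinuousLinearMap.opNorm_le_of_unit_norm (𝕜 := 𝕜) (by positivity) fun x hx => ?_
      exact h x.1 (le_of_eq hx) (hGS _ x.2) f hf f₀ hf₀
    -- `f - f₀ - e` vanishes on the common kernel `G`, hence lies in the span of `S`.
    obtain ⟨e, he, hen⟩ := exists_extension_norm_eq G ((f - f₀).comp G.subtypeL)
    have hmem : f - f₀ - e ∈ E := by
      have h1 : ((f - f₀ - e : StrongDual 𝕜 X) : X →ₗ[𝕜] 𝕜) ∈
          Submodule.span 𝕜 (range fun g : S => (g.1 : X →ₗ[𝕜] 𝕜)) := by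
        refine mem_span_of_iInf_ker_le_ker fun x hx => ?_
        have := he ⟨x, hx⟩
        simp at this
        simp [this]
      obtain ⟨c, hc⟩ := (Submodule.mem_span_range_iff_exists_fun 𝕜).1 h1
      have h2 : f - f₀ - e = ∑ i : S, c i • i.1 := by
        ext x
        have := LinearMap.congr_fun hc x
        simp at this
        simp [← this]
      rw [h2]
      exact Submodule.sum_mem _ fun i _ => Submodule.smul_mem _ _ (Submodule.subset_span i.2)
    refine ⟨⟨_, hmem⟩, ?_⟩
    simpa [hen] using hle
  choose k hk using key
  have : FiniteDimensional 𝕜 E := FiniteDimensional.span_finset 𝕜 S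
  have : ProperSpace E := FiniteDimensional.proper 𝕜 E
  have hW' : ¬ (univ : Set W).Countable := by rwa [countable_univ_iff]
  -- Three errors of `ε / 4` add up to less than the separation `ε`.
  obtain ⟨a, -, b, -, hab, hd⟩ :=
    exists_ne_dist_lt_of_not_countable hW' k (c := ε / 4) (by positivity)
  have h1 : ε < dist a.1 b.1 := hsep a.2 b.2 (fun h => hab (Subtype.ext h))
  have h2 : a.1 - b.1 = (a.1 - f₀ - k a) - (b.1 - f₀ - k b) + ((k a : StrongDual 𝕜 X) - k b) := by
    abel
  rw [dist_eq_norm, h2] at h1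
  rw [Subtype.dist_eq, dist_eq_norm] at hd
  linarith [norm_add_le ((a.1 - f₀ - k a) - (b.1 - f₀ - k b)) ((k a : StrongDual 𝕜 X) - k b),
    norm_sub_le (a.1 - f₀ - k a) (b.1 - f₀ - k b), hk a, hk b]

/-- Mazur's lemma: finitely many functionals almost norm a finite-dimensional subspace, modulo
their common kernel. -/
theorem exists_finset_norm_le_mul_norm_add (F : Submodule 𝕜 X) [FiniteDimensional 𝕜 F]
    {δ : ℝ} (hδ : 0 < δ) :
    ∃ S : Finset (StrongDual 𝕜 X), ∀ y ∈ F, ∀ z, (∀ g ∈ S, g z = 0) →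
      ‖y‖ ≤ (1 + δ) * ‖y + z‖ := by
  classical
  have : ProperSpace F := FiniteDimensional.proper 𝕜 F
  set r : ℝ := δ / (1 + δ)
  have hr : 0 < r := by positivity
  obtain ⟨t, ht, htf, hcov⟩ := (isCompact_sphere (0 : F) 1).finite_cover_balls hr
  choose φ hφ hφx using fun x : X => exists_dual_vector'' 𝕜 x
  refine ⟨htf.toFinset.image fun x : F => φ x, fun y hy z hz => ?_⟩
  rcases eq_or_ne y 0 with rfl | hy0
  · simp; positivity
  have hny : 0 < ‖y‖ := norm_pos_iff.2 hy0
  set u : F := ((‖y‖⁻¹ : ℝ) : 𝕜) • ⟨y, hy⟩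
  have hu : ‖u‖ = 1 := by
    simp [u, norm_smul, hny.ne']
  have hyu : y = ((‖y‖ : ℝ) : 𝕜) • (u : X) := by
    simp [u, smul_smul, hy0]
  obtain ⟨x, hx, hux⟩ := mem_iUnion₂.1 (hcov (mem_sphere_zero_iff_norm.2 hu))
  have hx1 : ‖(x : X)‖ = 1 := mem_sphere_zero_iff_norm.1 (ht hx)
  have hφz : φ x z = 0 := hz _ (Finset.mem_image_of_mem (fun x : F => φ x) (htf.mem_toFinset.2 hx))
  have h1 : 1 - r ≤ ‖φ x u‖ := by
    have h2 : ‖φ x (x - u : X)‖ ≤ r := by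
      refine ((φ x).le_of_opNorm_le (hφ x) _).trans ?_
      rw [Metric.mem_ball, dist_comm, Subtype.dist_eq, dist_eq_norm] at hux
      simpa using hux.le
    have h3 : ‖φ x (x : X)‖ = 1 := by simp [hφx, hx1]
    have h4 : φ x (x : X) = φ x (x - u : X) + φ x u := by simp
    linarith [h4 ▸ norm_add_le (φ x (x - u : X)) (φ x u)]
  have h5 : ‖y‖ * (1 - r) ≤ ‖y + z‖ := by
    calc ‖y‖ * (1 - r) ≤ ‖y‖ * ‖φ x u‖ := by gcongr
      _ = ‖φ x y‖ := by
        conv_rhs => rw [hyu]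
        simp
      _ = ‖φ x (y + z)‖ := by rw [map_add, hφz, add_zero]
      _ ≤ ‖y + z‖ := by simpa using (φ x).le_of_opNorm_le (hφ x) (y + z)
  have h6 : (1 + δ) * (1 - r) = 1 := by
    simp only [r]; field_simp; ring
  calc ‖y‖ = (1 + δ) * (‖y‖ * (1 - r)) := by rw [mul_left_comm, h6, mul_one]
    _ ≤ _ := by gcongr

/-- A total sequence of non-zero vectors whose partial sum operators are bounded by `C` on finite
linear combinations is a Schauder basis with projections bounded by `C`. -/
theorem exists_schauderBasis_of_norm_sum_range_le {v : ℕ → X} (hv : ∀ n, v n ≠ 0)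
    (hd : Dense (Submodule.span 𝕜 (range v) : Set X)) {C : ℝ} (hC0 : 0 ≤ C)
    (hC : ∀ n (a : ℕ →₀ 𝕜), ‖∑ i ∈ Finset.range n, a i • v i‖ ≤
      C * ‖Finsupp.linearCombination 𝕜 v a‖) :
    ∃ b : SchauderBasis 𝕜 X, ∀ n, ‖b.proj n‖ ≤ C := by
  set e := Finsupp.linearCombination 𝕜 v
  have he : DenseRange e := by
    have : range e = (Submodule.span 𝕜 (range v) : Set X) := by
      rw [← Finsupp.range_linearCombination]; rfl
    rw [DenseRange, this]; exact hd
  -- `a n • v n` is a difference of consecutive partial sums, whence the factor 2.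
  have hcoord : ∀ n (a : ℕ →₀ 𝕜), ‖Finsupp.lapply (R := 𝕜) n a‖ ≤ (2 * C / ‖v n‖) * ‖e a‖ := by
    intro n a
    have hn : 0 < ‖v n‖ := norm_pos_iff.2 (hv n)
    rw [div_mul_eq_mul_div, le_div_iff₀ hn, Finsupp.lapply_apply, ← norm_smul]
    have h1 := hC (n + 1) a
    have h2 := hC n a
    have h3 : a n • v n = ∑ i ∈ Finset.range (n + 1), a i • v i
        - ∑ i ∈ Finset.range n, a i • v i := by
      rw [Finset.sum_range_succ, add_sub_cancel_left]
    rw [h3]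
    linarith [norm_sub_le (∑ i ∈ Finset.range (n + 1), a i • v i)
      (∑ i ∈ Finset.range n, a i • v i)]
  set φ : ℕ → StrongDual 𝕜 X := fun n => (Finsupp.lapply (R := 𝕜) n).extendOfNorm e
  have hφ : ∀ n a, φ n (e a) = a n := fun n a =>
    LinearMap.extendOfNorm_eq he ⟨_, hcoord n⟩ a
  set Q : ℕ → X →L[𝕜] X := fun n => ∑ i ∈ Finset.range n, (φ i).smulRight (v i)
  have hQ : ∀ n x, Q n x = ∑ i ∈ Finset.range n, φ i x • v i := fun n x => by
    simp [Q]
  have hQn : ∀ n x, ‖Q n x‖ ≤ C * ‖x‖ := fun n => by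
    refine fun x => he.induction_on x (isClosed_le (by fun_prop) (by fun_prop)) fun a => ?_
    rw [hQ]
    simpa only [hφ] using hC n a
  have hlim : ∀ x, Tendsto (fun n => Q n x) atTop (𝓝 x) := by
    intro x
    rw [Metric.tendsto_atTop]
    intro ε hε
    obtain ⟨a, ha⟩ := he.exists_dist_lt x (ε := ε / (C + 1)) (by positivity)
    obtain ⟨N, hN⟩ := a.support.exists_nat_subset_range
    refine ⟨N, fun n hn => ?_⟩
    have h1 : Q n (e a) = e a := by
      rw [hQ]
      simp only [hφ]
      exact (Finsupp.sum_of_support_subset a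
        (hN.trans (Finset.range_subset_range.2 hn)) (fun i c => c • v i) (by simp)).symm
    rw [dist_eq_norm] at ha ⊢
    have h2 : Q n x - x = Q n (x - e a) - (x - e a) := by rw [map_sub, h1]; abel
    rw [h2]
    calc _ ≤ C * ‖x - e a‖ + ‖x - e a‖ := (norm_sub_le _ _).trans (by gcongr; exact hQn n _)
      _ = (C + 1) * ‖x - e a‖ := by ring
      _ < (C + 1) * (ε / (C + 1)) := by gcongr
      _ = ε := by field_simp
  let b : SchauderBasis 𝕜 X :=
    { basis := v
      coord := φ
      ortho := fun i j => by
        have h1 : e (Finsupp.single j 1) = v j := by simp [e]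
        rw [← h1, hφ]
        rcases eq_or_ne i j with rfl | hij
        · simp
        · simp [hij]
      expansion := fun x => by
        rw [HasSum, SummationFilter.conditional_filter_eq_map_range, tendsto_map'_iff]
        exact (hlim x).congr fun n => hQ n x }
  refine ⟨b, fun n => ContinuousLinearMap.opNorm_le_bound _ hC0 fun x => ?_⟩
  rw [SchauderBasis.proj_apply]
  exact (hQ n x) ▸ hQn n x

/-- If `x n` is chosen, given its predecessors, in a set that meets every finite-codimensional
subspace, the sequence can be made basic with constant `1 + δ`. -/
theorem exists_basic_seq {p : ℕ → X → Prop}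
    (hp : ∀ n (S : Finset (StrongDual 𝕜 X)), ∃ x, p n x ∧ ∀ g ∈ S, g x = 0)
    {δ : ℝ} (hδ : 0 < δ) :
    ∃ x : ℕ → X, (∀ n, p n (x n)) ∧ ∀ n (a : ℕ →₀ 𝕜),
      ‖∑ i ∈ Finset.range n, a i • x i‖ ≤ (1 + δ) * ‖Finsupp.linearCombination 𝕜 x a‖ := by
  classical
  have hM : ∀ L : Finset X, ∃ S : Finset (StrongDual 𝕜 X),
      ∀ y ∈ Submodule.span 𝕜 (L : Set X), ∀ z, (∀ g ∈ S, g z = 0) →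
        ‖y‖ ≤ (1 + δ) * ‖y + z‖ := fun L =>
    have : FiniteDimensional 𝕜 (Submodule.span 𝕜 (L : Set X)) :=
      FiniteDimensional.span_finset 𝕜 L
    exists_finset_norm_le_mul_norm_add _ hδ
  choose S hS using hM
  -- Using all subsets of `L` keeps the constraints of every earlier stage in force.
  choose next hnext hnextS using fun n (L : Finset X) => hp n (L.powerset.biUnion S)
  let H : ℕ → Finset X := fun n => Nat.rec ∅ (fun n L => insert (next n L) L) n
  have hsucc : ∀ n, H (n + 1) = insert (next n (H n)) (H n) := fun n => rfl
  have hmono : Monotone H := monotone_nat_of_le_succ fun n => by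
    rw [hsucc]; exact Finset.subset_insert _ _
  set x : ℕ → X := fun n => next n (H n)
  have hxH : ∀ {i n}, i < n → x i ∈ H n := fun {i n} hin =>
    hmono (Nat.succ_le_of_lt hin) (by rw [hsucc]; exact Finset.mem_insert_self _ _)
  have hxS : ∀ {n i}, n ≤ i → ∀ g ∈ S (H n), g (x i) = 0 := fun {n i} hni g hg =>
    hnextS i (H i) g (Finset.mem_biUnion.2 ⟨H n, Finset.mem_powerset.2 (hmono hni), hg⟩)
  refine ⟨x, fun n => hnext n _, fun n a => ?_⟩
  obtain ⟨N, hN⟩ := a.support.exists_nat_subset_range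
  have h1 : Finsupp.linearCombination 𝕜 x a = ∑ i ∈ Finset.range n, a i • x i
      + ∑ i ∈ Finset.Ico n (n + N), a i • x i := by
    rw [Finset.sum_range_add_sum_Ico _ (Nat.le_add_right n N)]
    exact Finsupp.sum_of_support_subset a
      (hN.trans (Finset.range_subset_range.2 (Nat.le_add_left N n))) (fun i c => c • x i) (by simp)
  rw [h1]
  refine hS (H n) _ (Submodule.sum_mem _ fun i hi => Submodule.smul_mem _ _
    (Submodule.subset_span (hxH (Finset.mem_range.1 hi)))) _ fun g hg => ?_
  rw [map_sum]
  refine Finset.sum_eq_zero fun i hi => ?_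
  rw [map_smul, hxS (Finset.mem_Ico.1 hi).1 g hg, smul_zero]

/-! ### Non-separability of the dual -/

/-- In the dual of a separable space, non-separability is witnessed by countably many uncountable
separated families, which every countable weak-star closed cover of a ball must detect. -/
theorem exists_seq_separated_of_not_separable_dual [TopologicalSpace.SeparableSpace X]
    (hX : ¬ TopologicalSpace.SeparableSpace (StrongDual 𝕜 X)) :
    ∃ ε > 0, ∃ W : ℕ → Set (StrongDual 𝕜 X),
      (∀ n, ¬ (W n).Countable ∧ (W n).Pairwise fun f g => ε < dist f g) ∧
      ∀ C : ℕ → Set (WeakDual 𝕜 X), (∀ j, IsClosed (C j)) → ⋃ j, C j = univ →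
        ∃ n j, ∀ f ∈ W n, StrongDual.toWeakDual f ∈ C j := by
  obtain ⟨ε, hε, A, hA, hsep⟩ := exists_uncountable_separated hX
  obtain ⟨N, hN⟩ : ∃ N : ℕ, ¬ (A ∩ Metric.closedBall 0 N).Countable := by
    by_contra! h
    refine hA ?_
    rw [← inter_univ A, ← Metric.iUnion_closedBall_nat (0 : StrongDual 𝕜 X), inter_iUnion]
    exact countable_iUnion h
  set K : Set (WeakDual 𝕜 X) := WeakDual.toStrongDual ⁻¹' Metric.closedBall 0 (N : ℝ)
  have hK : IsCompact K := WeakDual.isCompact_closedBall 0 (N : ℝ)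
  have : CompactSpace K := isCompact_iff_compactSpace.1 hK
  have : TopologicalSpace.MetrizableSpace K := WeakDual.metrizable_of_isCompact 𝕜 X K hK
  let _ := TopologicalSpace.metrizableSpaceMetric K
  have : SecondCountableTopology K := inferInstance
  let ι : K → StrongDual 𝕜 X := fun f => WeakDual.toStrongDual f.1
  have hι : Function.Injective ι := fun f g h => Subtype.ext (WeakDual.toStrongDual.injective h)
  have himg : ι '' (ι ⁻¹' A) = A ∩ Metric.closedBall 0 N := by
    ext f
    constructor
    · rintro ⟨g, hg, rfl⟩
      exact ⟨hg, g.2⟩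
    · rintro ⟨h1, h2⟩
      exact ⟨⟨StrongDual.toWeakDual f, h2⟩, h1, rfl⟩
  obtain ⟨W, hW, hWC⟩ := exists_seq_uncountable_subset_of_closed_cover (A := ι ⁻¹' A)
    (fun h => hN (himg ▸ h.image ι))
  refine ⟨ε, hε, fun n => ι '' W n, fun n => ⟨fun h => (hW n).2 ?_, ?_⟩, fun C hC hU => ?_⟩
  · exact countable_of_injective_of_countable_image hι.injOn h
  · exact hsep.mono (image_subset_iff.2 (hW n).1)
  · obtain ⟨n, j, h⟩ := hWC (fun j => (↑) ⁻¹' C j) (fun j => (hC j).preimage continuous_subtype_val)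
      (by rw [← preimage_iUnion, hU, preimage_univ])
    refine ⟨n, j, ?_⟩
    rintro _ ⟨f, hf, rfl⟩
    exact h hf

end Banach

theorem mainTheorem6 {𝕜 : Type*} [RCLike 𝕜]
    {X : Type*} [NormedAddCommGroup X] [NormedSpace 𝕜 X] [CompleteSpace X]
    [TopologicalSpace.SeparableSpace X]
    (hX : ¬ TopologicalSpace.SeparableSpace (StrongDual 𝕜 X))
    (δ : ℝ) (hδ : 0 < δ) :
    ∃ Y : Submodule 𝕜 X, IsClosed (Y : Set X) ∧
      ¬ TopologicalSpace.SeparableSpace (StrongDual 𝕜 Y) ∧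
      ∃ b : SchauderBasis 𝕜 Y, b.enormProjBound ≤ ENNReal.ofReal (1 + δ) := by
  obtain ⟨ε, hε, W, hW, hcov⟩ := exists_seq_separated_of_not_separable_dual hX
  obtain ⟨x, hx, hbasic⟩ := exists_basic_seq (𝕜 := 𝕜)
    (p := fun n x => ‖x‖ ≤ 1 ∧ ∃ f ∈ W n, ∃ f' ∈ W n, ε / 4 < ‖f x - f' x‖)
    (fun n S => by
      obtain ⟨x, h1, h2, h3⟩ := exists_separating_vector S hε (hW n).1 (hW n).2
      exact ⟨x, ⟨h1, h3⟩, h2⟩) hδ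
  set Y : Submodule 𝕜 X := (Submodule.span 𝕜 (range x)).topologicalClosure
  have hxY : ∀ n, x n ∈ Y := fun n =>
    Submodule.le_topologicalClosure _ (Submodule.subset_span (mem_range_self n))
  refine ⟨Y, Submodule.isClosed_topologicalClosure _, fun hsepY => ?_, ?_⟩
  · let d := TopologicalSpace.denseSeq (StrongDual 𝕜 Y)
    obtain ⟨n, j, hnj⟩ := hcov
      -- Weak-star closed, being an intersection of pointwise conditions; `ε / 8` is half the gap at
      -- `x n`.
      (fun j => {f | ∀ y : Y, ‖f (y : X) - d j y‖ ≤ ε / 8 * ‖y‖})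
      (fun j => by
        simp only [ofPred_forall]
        exact isClosed_iInter fun y => isClosed_le
          ((WeakDual.eval_continuous (y : X)).sub continuous_const).norm continuous_const)
      (eq_univ_of_forall fun f => by
        obtain ⟨j, hj⟩ := (TopologicalSpace.denseRange_denseSeq (StrongDual 𝕜 Y)).exists_dist_lt
          ((WeakDual.toStrongDual f).comp Y.subtypeL) (ε := ε / 8) (by positivity)
        rw [dist_eq_norm] at hj
        exact mem_iUnion.2 ⟨j, fun y => ContinuousLinearMap.le_of_opNorm_le _ hj.le y⟩)
    obtain ⟨hx1, f, hf, f', hf', hlt⟩ := hx n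
    have h1 : ‖f (x n) - d j ⟨x n, hxY n⟩‖ ≤ ε / 8 * ‖x n‖ := hnj f hf ⟨x n, hxY n⟩
    have h2 : ‖f' (x n) - d j ⟨x n, hxY n⟩‖ ≤ ε / 8 * ‖x n‖ := hnj f' hf' ⟨x n, hxY n⟩
    have h3 : ε / 8 * ‖x n‖ ≤ ε / 8 := mul_le_of_le_one_right (by positivity) hx1
    have h4 := norm_sub_le (f (x n) - d j ⟨x n, hxY n⟩) (f' (x n) - d j ⟨x n, hxY n⟩)
    rw [sub_sub_sub_cancel_right] at h4
    linarith
  · let v : ℕ → Y := fun n => ⟨x n, hxY n⟩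
    have hlin : ∀ a : ℕ →₀ 𝕜, ((Finsupp.linearCombination 𝕜 v a : Y) : X) =
        Finsupp.linearCombination 𝕜 x a := fun a => by
      simp [Finsupp.linearCombination_apply, Finsupp.sum, v]
    obtain ⟨b, hb⟩ := exists_schauderBasis_of_norm_sum_range_le (𝕜 := 𝕜) (v := v) (C := 1 + δ)
      (fun n h => by
        obtain ⟨-, f, -, f', -, hlt⟩ := hx n
        have h0 : x n = 0 := congrArg Subtype.val h
        simp [h0] at hlt
        linarith)
      (by
        have hspan : (Subtype.val '' (Submodule.span 𝕜 (range v) : Set Y) : Set X) =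
            Submodule.span 𝕜 (range x) := by
          rw [← Submodule.coe_subtype, ← Submodule.map_coe, Submodule.map_span, ← range_comp]
          rfl
        rw [Subtype.dense_iff]
        exact (Submodule.topologicalClosure_coe _).le.trans (closure_mono hspan.ge))
      (by positivity)
      (fun n a => by
        have := hbasic n a
        rw [← hlin] at this
        simpa [v] using this)
    refine ⟨b, iSup_le fun n => ?_⟩
    rw [← ofReal_norm]
    exact ENNReal.ofReal_le_ofReal (hb n)
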